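/- All automata are over an arbitrary finite alphabet $\Sigma$, have a finite state set $Q$, a start state $q_s\in Q$ and a set $Q_a\subseteq Q$ of accepting states, and read an input $w\in\Sigma^*$ as the word $\tilde w=\mathord{\text{¢}}\,w\,\$$, symbol by symbol from left to right, where ¢ and $\$$ are end-markers not in $\Sigma$. - A probabilistic finite automaton (PFA) $P$ has, for every $\sigma\in\Sigma\cup\{\text{¢},\$\}$, a real matrix $A_\sigma$ whose columns are probability vectors. With final vector $v_f=A_{\tilde w_{|\tilde w|}}\cdots A_{\tilde w_1}e_{q_s}$, its accepting probability is $f_P(w)=\sum_{q\in Q_a}v_f[q]$. - An affine finite automaton (AfA) $M$ has real matrices $A_\sigma$, each of whose columns has entries summing to $1$. With $v_f$ defined in the same way, its accepting value is $f_M(w)=\sum_{q\in Q_a}|v_f[q]|\big/\sum_{q\in Q}|v_f[q]|$. - A quantum finite automaton (QFA) $M$ has, for every $\sigma$, a superoperator $\mathcal E_\sigma(\rho)=\sum_{j=1}^m E_j\rho E_j^\dagger$, where $m>0$ and the $E_j$ are complex $Q\times Q$ matrices (depending on $\sigma$, as may $m$) with $\sum_j E_j^\dagger E_j=I$. Starting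 from $|q_s\rangle\langle q_s|$ and applying $\mathcal E_{\tilde w_1},\mathcal E_{\tilde w_2},\dots$ gives a final mixed state $\rho_f$, and $f_M(w)=\sum_{q\in Q_a}\rho_f[q,q]$. Classes of languages (over all finite alphabets): $\mathsf{SL}^{\neq}$ (respectively $\mathsf{AfL}^{\neq}$) consists of the languages of the form $\{w\in\Sigma^*\mid f_M(w)\ne\lambda\}$ for a PFA (respectively AfA) $M$ and some $\lambda\in[0,1]$. $\mathsf{NQAL}$ (respectively $\mathsf{NAfL}$) consists of the languages of the form $\{w\in\Sigma^*\mid f_M(w)>0\}$ for a QFA (respectively AfA) $M$. For a class $\mathsf C$, $\overline{\mathsf C}$ is the class of the complements $\Sigma^*\setminus L$ of the languages $L\subseteq\Sigma^*$ in $\mathsf C$; put $\mathsf{SL}^{=}=\overline{\mathsf{SL}^{\neq}}$ and $\mathsf{AfL}^{=}=\overline{\mathsf{AfL}^{\neq}}$. Then $$\mathsf{SL}^{=}=\overline{\mathsf{NQAL}}=\overline{\mathsf{NAfL}}\subsetneq\mathsf{AfL}^{=} \qquad\text{and}\qquad \mathsf{SL}^{\neq}=\mathsf{NQAL}=\mathsf{NAfL}\subsetneq\mathsf{AfL}^{\neq}.$$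 The separation is witnessed by the language $\mathtt{ABS\mbox{-}EQ}$ of all words $w\in\{a,b\}^*$ such that, with $m$ the number of letters $a$ and $n$ the number of letters $b$ in $w$, $$|m-n|+|m-4n|=|m-2n|+|m-3n|:$$ $\mathtt{ABS\mbox{-}EQ}\in\mathsf{AfL}^{=}\setminus\mathsf{SL}^{=}$, and its complement $\{a,b\}^*\setminus\mathtt{ABS\mbox{-}EQ}$ lies in $\mathsf{AfL}^{\neq}\setminus\mathsf{SL}^{\neq}$. -/

import Mathlib

open scoped Matrix

namespace AffineAutomata

/-- The extended alphabet: the letters of `α` and the two end-markers. -/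
inductive Tape (α : Type) where
  | left : Tape α
  | letter : α → Tape α
  | right : Tape α

/-- The word on the tape: the input between the left and the right end-marker. -/
def tape {α : Type} (w : List α) : List (Tape α) :=
  Tape.left :: (w.map Tape.letter ++ [Tape.right])

/-! ### Probabilistic finite automata -/

/-- A probabilistic finite automaton over the alphabet `α` with finite set of states `Q`. The
transition matrices are left stochastic: every column is a probability vector. -/
structure PFA (α Q : Type) [Fintype Q] [DecidableEq Q] where
  trans : Tape α → Matrix Q Q ℝ
  stochastic : ∀ σ, trans σ ∈ Matrix.colStochastic ℝ Q
  start : Q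
  accept : Finset Q

/-- The final probabilistic state of a PFA on `w`. -/
def PFA.finalState {α Q : Type} [Fintype Q] [DecidableEq Q] (P : PFA α Q) (w : List α) : Q → ℝ :=
  (tape w).foldl (fun v σ => P.trans σ *ᵥ v) (Pi.single P.start 1)

/-- The accepting probability of a PFA on `w`. -/
def PFA.value {α Q : Type} [Fintype Q] [DecidableEq Q] (P : PFA α Q) (w : List α) : ℝ :=
  ∑ q ∈ P.accept, P.finalState w q

/-! ### Affine finite automata -/

/-- An affine operator: the entries of every column sum to one. -/
def IsAffine {Q : Type} [Fintype Q] (A : Matrix Q Q ℝ) : Prop :=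
  ∀ j, ∑ i, A i j = 1

/-- An affine finite automaton over the alphabet `α` with finite set of states `Q`. -/
structure AfA (α Q : Type) [Fintype Q] where
  trans : Tape α → Matrix Q Q ℝ
  affine : ∀ σ, IsAffine (trans σ)
  start : Q
  accept : Finset Q

/-- The final affine state of an AfA on `w`. -/
def AfA.finalState {α Q : Type} [Fintype Q] [DecidableEq Q] (M : AfA α Q) (w : List α) : Q → ℝ :=
  (tape w).foldl (fun v σ => M.trans σ *ᵥ v) (Pi.single M.start 1)

/-- The accepting value of an AfA on `w`, obtained by weighting the final affine state. The
denominator is at least one, since the entries of an affine state sum to one. -/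
noncomputable def AfA.value {α Q : Type} [Fintype Q] [DecidableEq Q] (M : AfA α Q) (w : List α) :
    ℝ :=
  ∑ q ∈ M.accept, |M.finalState w q| / ∑ r, |M.finalState w r|

/-! ### Quantum finite automata -/

/-- A superoperator, given by finitely many operation elements `E j` with `∑ j, (E j)ᴴ * E j = 1`. -/
structure Superoperator (Q : Type) [Fintype Q] [DecidableEq Q] where
  size : ℕ
  size_pos : 0 < size
  elements : Fin size → Matrix Q Q ℂ
  complete : ∑ j, (elements j)ᴴ * elements j = 1

/-- The action `ρ ↦ ∑ j, E j * ρ * (E j)ᴴ` of a superoperator on mixed states. -/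
def Superoperator.apply {Q : Type} [Fintype Q] [DecidableEq Q] (E : Superoperator Q)
    (ρ : Matrix Q Q ℂ) : Matrix Q Q ℂ :=
  ∑ j, E.elements j * ρ * (E.elements j)ᴴ

/-- A quantum finite automaton over the alphabet `α` with finite set of basis states `Q`. -/
structure QFA (α Q : Type) [Fintype Q] [DecidableEq Q] where
  trans : Tape α → Superoperator Q
  start : Q
  accept : Finset Q

/-- The final mixed state of a QFA on `w`; the initial one is the projector on the start state. -/
def QFA.finalState {α Q : Type} [Fintype Q] [DecidableEq Q] (M : QFA α Q) (w : List α) :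
    Matrix Q Q ℂ :=
  (tape w).foldl (fun ρ σ => (M.trans σ).apply ρ) (Matrix.single M.start M.start 1)

/-- The accepting probability of a QFA on `w`. The diagonal entries of a mixed state are
nonnegative real numbers, so that taking real parts loses nothing. -/
def QFA.value {α Q : Type} [Fintype Q] [DecidableEq Q] (M : QFA α Q) (w : List α) : ℝ :=
  ∑ q ∈ M.accept, (M.finalState w q q).re

/-! ### Classes of languages -/

/-- A language together with its finite alphabet. A class of languages is a set of these. -/
structure FormalLanguage where
  Alphabet : Type
  finite_alphabet : Finite Alphabet
  words : Language Alphabet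

/-- The complement of a language, over the same alphabet. -/
def FormalLanguage.compl (L : FormalLanguage) : FormalLanguage where
  Alphabet := L.Alphabet
  finite_alphabet := L.finite_alphabet
  words := L.wordsᶜ

/-- The class of the complements of the languages of a class. -/
def co (C : Set FormalLanguage) : Set FormalLanguage := {L | L.compl ∈ C}

/-- Exclusive stochastic languages. -/
def SLne : Set FormalLanguage :=
  {L | ∃ (Q : Type) (_ : Fintype Q) (_ : DecidableEq Q) (P : PFA L.Alphabet Q),
    ∃ c ∈ Set.Icc (0 : ℝ) 1, ∀ w, w ∈ L.words ↔ P.value w ≠ c}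

/-- The complement class of `SLne`. -/
def SLeq : Set FormalLanguage := co SLne

/-- Exclusive affine languages. -/
def AfLne : Set FormalLanguage :=
  {L | ∃ (Q : Type) (_ : Fintype Q) (_ : DecidableEq Q) (M : AfA L.Alphabet Q),
    ∃ c ∈ Set.Icc (0 : ℝ) 1, ∀ w, w ∈ L.words ↔ M.value w ≠ c}

/-- The complement class of `AfLne`. -/
def AfLeq : Set FormalLanguage := co AfLne

/-- Nondeterministic affine languages: recognized by an AfA with cutpoint zero. -/
def NAfL : Set FormalLanguage :=
  {L | ∃ (Q : Type) (_ : Fintype Q) (_ : DecidableEq Q) (M : AfA L.Alphabet Q),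
    ∀ w, w ∈ L.words ↔ 0 < M.value w}

/-- Nondeterministic quantum automata languages: recognized by a QFA with cutpoint zero. -/
def NQAL : Set FormalLanguage :=
  {L | ∃ (Q : Type) (_ : Fintype Q) (_ : DecidableEq Q) (M : QFA L.Alphabet Q),
    ∀ w, w ∈ L.words ↔ 0 < M.value w}

/-- The alphabet with two letters `a` and `b`. -/
inductive AB where
  | a
  | b
  deriving DecidableEq

instance : Finite AB :=
  Finite.of_surjective (fun t : Bool => if t then AB.a else AB.b) fun x => by
    cases x
    · exact ⟨true, rfl⟩
    · exact ⟨false, rfl⟩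

/-- The language `ABS-EQ` over `{a, b}`. -/
def absEq : FormalLanguage where
  Alphabet := AB
  finite_alphabet := inferInstance
  words := {w | |(w.count AB.a : ℤ) - w.count AB.b| + |(w.count AB.a : ℤ) - 4 * w.count AB.b| =
    |(w.count AB.a : ℤ) - 2 * w.count AB.b| + |(w.count AB.a : ℤ) - 3 * w.count AB.b|}

end AffineAutomata

open scoped ComplexOrder

namespace AffineAutomata

/-! All three classes in the equalities are the class `IsSupport` of supports of real rational
series. One inclusion linearizes each acceptance condition: a cutpoint becomes a linear functional
because probabilities sum to one, affine values are handled through the square `v vᵀ`, and mixed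
states already evolve linearly. Conversely, `IsSupport.exists_run` turns a support into arbitrary
real matrices, which each model simulates up to positive factors: as a perturbation of the uniform
stochastic matrix, by one extra affine row, or by one Kraus operator completed to a superoperator.

For the separation, on words `a^m b^n` a series is, for fixed `m`, a linear recurrence in `n`. By
Cayley–Hamilton, if it vanishes for all large `n`, it vanishes from a bound independent of `m`
(`exists_pow_apply_eq_zero`). But `ABS-EQ` requires `m ≤ n` or `4n ≤ m`, and the gap between these
ranges moves to infinity with `m`. An AfA tests the equation directly, since its weighting computes
absolute values. -/

/-- The language is the support of a rational series over the reals: a word belongs to it if and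
only if a linear functional does not vanish on the vector obtained by applying to a fixed vector
the linear maps attached to the symbols on the tape. -/
def IsSupport (L : FormalLanguage) : Prop :=
  ∃ (V : Type) (_ : AddCommGroup V) (_ : Module ℝ V) (_ : FiniteDimensional ℝ V)
    (_ : Nontrivial V) (T : Tape L.Alphabet → V →ₗ[ℝ] V) (v : V) (φ : V →ₗ[ℝ] ℝ),
    ∀ w, w ∈ L.words ↔ φ ((tape w).foldl (fun x σ => T σ x) v) ≠ 0

/-- The vector obtained by applying matrices along the tape to the basis vector of `s`. -/
def run {α Q : Type} [Fintype Q] [DecidableEq Q] (A : Tape α → Matrix Q Q ℝ) (s : Q)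
    (l : List (Tape α)) : Q → ℝ :=
  l.foldl (fun v σ => A σ *ᵥ v) (Pi.single s 1)

/-- A relation between two states which is preserved by every step is preserved by folding. -/
theorem foldl_rel {σ β γ : Type*} (R : β → γ → Prop) (f : β → σ → β) (g : γ → σ → γ)
    (h : ∀ x y s, R x y → R (f x s) (g y s)) (l : List σ) (x : β) (y : γ) (hxy : R x y) :
    R (l.foldl f x) (l.foldl g y) := by
  induction l generalizing x y with
  | nil => exact hxy
  | cons s l ih => exact ih _ _ (h _ _ _ hxy)

theorem foldl_inv {σ β : Type*} (R : β → Prop) (f : β → σ → β)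
    (h : ∀ x s, R x → R (f x s)) (l : List σ) (x : β) (hx : R x) : R (l.foldl f x) :=
  foldl_rel (fun x _ => R x) f (fun (u : Unit) _ => u) (fun x _ s hx => h x s hx) l x () hx

/-! ### From automata to supports of rational series -/

theorem IsAffine.sum_mulVec {Q : Type} [Fintype Q] {A : Matrix Q Q ℝ} (hA : IsAffine A)
    (v : Q → ℝ) : ∑ i, (A *ᵥ v) i = ∑ i, v i := by
  simp only [Matrix.mulVec, dotProduct]
  rw [Finset.sum_comm]
  exact Finset.sum_congr rfl fun j _ => by rw [← Finset.sum_mul, hA j, one_mul]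

theorem IsAffine.of_colStochastic {Q : Type} [Fintype Q] [DecidableEq Q] {A : Matrix Q Q ℝ}
    (hA : A ∈ Matrix.colStochastic ℝ Q) : IsAffine A :=
  fun j => Matrix.sum_col_of_mem_colStochastic hA j

theorem IsSupport.of_SLne {L : FormalLanguage} (hL : L ∈ SLne) : IsSupport L := by
  obtain ⟨Q, _, _, P, c, -, h⟩ := hL
  have : Nonempty Q := ⟨P.start⟩
  refine ⟨Q → ℝ, inferInstance, inferInstance, inferInstance, inferInstance,
    fun σ => (P.trans σ).mulVecLin, Pi.single P.start 1,
    ∑ q ∈ P.accept, LinearMap.proj q - c • ∑ q, LinearMap.proj q, fun w => ?_⟩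
  have h1 : ∑ q, P.finalState w q = 1 :=
    foldl_inv (fun v : Q → ℝ => ∑ q, v q = 1) _
      (fun v σ hv => by rw [(IsAffine.of_colStochastic (P.stochastic σ)).sum_mulVec, hv])
      _ _ (by simp)
  rw [h w, PFA.value, ← sub_ne_zero]
  simp only [LinearMap.sub_apply, LinearMap.smul_apply, LinearMap.sum_apply, LinearMap.proj_apply,
    Matrix.mulVecLin_apply, smul_eq_mul]
  change _ ↔ ∑ q ∈ P.accept, P.finalState w q - c * ∑ q, P.finalState w q ≠ 0
  rw [h1, mul_one]

theorem AfA.sum_finalState {α Q : Type} [Fintype Q] [DecidableEq Q] (M : AfA α Q) (w : List α) :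
    ∑ q, M.finalState w q = 1 :=
  foldl_inv (fun v : Q → ℝ => ∑ q, v q = 1) _
    (fun v σ hv => by rw [(M.affine σ).sum_mulVec, hv]) _ _ (by simp)

theorem AfA.one_le_norm {α Q : Type} [Fintype Q] [DecidableEq Q] (M : AfA α Q) (w : List α) :
    1 ≤ ∑ q, |M.finalState w q| := by
  rw [← M.sum_finalState w]
  exact Finset.sum_le_sum fun q _ => le_abs_self _

theorem AfA.value_nonneg {α Q : Type} [Fintype Q] [DecidableEq Q] (M : AfA α Q) (w : List α) :
    0 ≤ M.value w :=
  Finset.sum_nonneg fun _ _ => div_nonneg (abs_nonneg _) (Finset.sum_nonneg fun _ _ => abs_nonneg _)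

theorem AfA.value_ne_zero_iff {α Q : Type} [Fintype Q] [DecidableEq Q] (M : AfA α Q)
    (w : List α) : M.value w ≠ 0 ↔ ∃ q ∈ M.accept, M.finalState w q ≠ 0 := by
  have h1 := M.one_le_norm w
  rw [AfA.value, Ne, Finset.sum_eq_zero_iff_of_nonneg
    fun _ _ => div_nonneg (abs_nonneg _) (zero_le_one.trans h1)]
  push Not
  refine exists_congr fun q => and_congr_right fun _ => ?_
  rw [div_ne_zero_iff, abs_ne_zero]
  exact and_iff_left (by linarith)

theorem AfA.value_pos_iff {α Q : Type} [Fintype Q] [DecidableEq Q] (M : AfA α Q)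
    (w : List α) : 0 < M.value w ↔ M.value w ≠ 0 :=
  (M.value_nonneg w).lt_iff_ne.trans ne_comm

/-- Some accepting entry is nonzero iff the sum of their squares is, and this sum is linear in `v
vᵀ`, which evolves by `X ↦ A X Aᵀ`. -/
theorem IsSupport.of_NAfL {L : FormalLanguage} (hL : L ∈ NAfL) : IsSupport L := by
  obtain ⟨Q, _, _, M, h⟩ := hL
  have : Nonempty Q := ⟨M.start⟩
  refine ⟨Matrix Q Q ℝ, inferInstance, inferInstance, inferInstance, inferInstance,
    fun σ => LinearMap.mulLeft ℝ (M.trans σ) ∘ₗ LinearMap.mulRight ℝ (M.trans σ)ᵀ,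
    Matrix.vecMulVec (Pi.single M.start 1) (Pi.single M.start 1),
    ∑ q ∈ M.accept, Matrix.entryLinearMap ℝ ℝ q q, fun w => ?_⟩
  rw [foldl_rel (fun (X : Matrix Q Q ℝ) v => X = Matrix.vecMulVec v v) _
    (fun v σ => M.trans σ *ᵥ v) ?_ (tape w) _ (Pi.single M.start 1) rfl]
  · change _ ↔ (∑ q ∈ M.accept, Matrix.entryLinearMap ℝ ℝ q q)
      (Matrix.vecMulVec (M.finalState w) (M.finalState w)) ≠ 0
    rw [h w, M.value_pos_iff, M.value_ne_zero_iff, LinearMap.sum_apply]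
    simp only [Matrix.entryLinearMap_apply, Matrix.vecMulVec_apply]
    rw [Ne, Finset.sum_eq_zero_iff_of_nonneg fun _ _ => mul_self_nonneg _]
    simp
  · rintro _ v σ rfl
    simp only [LinearMap.comp_apply, LinearMap.mulRight_apply, LinearMap.mulLeft_apply]
    rw [Matrix.vecMulVec_mul, Matrix.mul_vecMulVec, Matrix.vecMul_transpose]

theorem Superoperator.apply_posSemidef {Q : Type} [Fintype Q] [DecidableEq Q]
    (E : Superoperator Q) {ρ : Matrix Q Q ℂ} (hρ : ρ.PosSemidef) : (E.apply ρ).PosSemidef :=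
  Matrix.posSemidef_sum _ fun _ _ => hρ.mul_mul_conjTranspose_same _

theorem QFA.value_nonneg {α Q : Type} [Fintype Q] [DecidableEq Q] (M : QFA α Q) (w : List α) :
    0 ≤ M.value w := by
  have h : (M.finalState w).PosSemidef := by
    refine foldl_inv Matrix.PosSemidef _ (fun ρ σ h => (M.trans σ).apply_posSemidef h) _ _ ?_
    rw [← Matrix.diagonal_single, Matrix.posSemidef_diagonal_iff]
    intro i
    by_cases hi : i = M.start
    · subst hi; simp
    · simp [hi]
  exact Finset.sum_nonneg fun q _ => (Complex.nonneg_iff.mp h.diag_nonneg).1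

/-- A superoperator as a real linear map. -/
noncomputable def Superoperator.toLinearMap {Q : Type} [Fintype Q] [DecidableEq Q] (E : Superoperator Q) :
    Matrix Q Q ℂ →ₗ[ℝ] Matrix Q Q ℂ :=
  ∑ j, LinearMap.mulRight ℝ (E.elements j)ᴴ ∘ₗ LinearMap.mulLeft ℝ (E.elements j)

theorem Superoperator.toLinearMap_apply {Q : Type} [Fintype Q] [DecidableEq Q]
    (E : Superoperator Q) (ρ : Matrix Q Q ℂ) : E.toLinearMap ρ = E.apply ρ := by
  simp [Superoperator.toLinearMap, Superoperator.apply, LinearMap.sum_apply]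

/-- Complex matrices are taken as a real vector space because the real part is only ℝ-linear.
Positivity of mixed states turns `> 0` into `≠ 0`. -/
theorem IsSupport.of_NQAL {L : FormalLanguage} (hL : L ∈ NQAL) : IsSupport L := by
  obtain ⟨Q, _, _, M, h⟩ := hL
  have : Nonempty Q := ⟨M.start⟩
  refine ⟨Matrix Q Q ℂ, inferInstance, inferInstance, inferInstance, inferInstance,
    fun σ => (M.trans σ).toLinearMap, Matrix.single M.start M.start 1,
    ∑ q ∈ M.accept, Complex.reLm ∘ₗ Matrix.entryLinearMap ℝ ℂ q q, fun w => ?_⟩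
  simp only [Superoperator.toLinearMap_apply, LinearMap.sum_apply, LinearMap.comp_apply,
    Matrix.entryLinearMap_apply]
  rw [h w, (M.value_nonneg w).lt_iff_ne, ne_comm]
  rfl

/-! ### Supports in matrix form -/

/-- A support can be presented by matrices, starting from and reading off one coordinate. -/
theorem IsSupport.exists_run {L : FormalLanguage} (hL : IsSupport L) :
    ∃ (n : ℕ) (A : Tape L.Alphabet → Matrix (Fin n) (Fin n) ℝ) (s : Fin n),
      ∀ w, w ∈ L.words ↔ run A s (tape w) s ≠ 0 := by
  obtain ⟨V, _, _, _, _, T, v, φ, h⟩ := hL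
  let b := Module.finBasis ℝ V
  let s : Fin (Module.finrank ℝ V) := ⟨0, Module.finrank_pos⟩
  -- Each end-marker occurs exactly once, so the left one can absorb `v` and the right one `φ`.
  let T' : Tape L.Alphabet → V →ₗ[ℝ] V := fun σ => match σ with
    | .left => (b.coord s).smulRight (T .left v)
    | .letter x => T (.letter x)
    | .right => (φ ∘ₗ T .right).smulRight (b s)
  refine ⟨_, fun σ => LinearMap.toMatrix b b (T' σ), s, fun w => ?_⟩
  have key : run (fun σ => LinearMap.toMatrix b b (T' σ)) s (tape w) =
      b.repr ((tape w).foldl (fun x σ => T' σ x) (b s)) :=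
    foldl_rel (fun (y : Fin _ → ℝ) x => y = b.repr x) _ _
      (by rintro _ x σ rfl; exact LinearMap.toMatrix_mulVec_repr b b _ _) _ _ _
      (by rw [b.repr_self, Finsupp.single_eq_pi_single])
  rw [h w, key, tape]
  simp [T', List.foldl_append, List.foldl_map]

/-! ### Simulation by probabilistic automata -/

/-- The matrix `A` bordered by two further rows and columns so that all row and column sums
vanish. -/
def bordered {Q : Type} [Fintype Q] (A : Matrix Q Q ℝ) : Matrix (Q ⊕ Bool) (Q ⊕ Bool) ℝ :=
  Matrix.fromBlocks A (Matrix.of fun i b => if b then 0 else -∑ j, A i j)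
    (Matrix.of fun b j => if b then -∑ i, A i j else 0)
    (Matrix.of fun b b' => if b && !b' then ∑ i, ∑ j, A i j else 0)

theorem bordered_sum_col {Q : Type} [Fintype Q] (A : Matrix Q Q ℝ) (j : Q ⊕ Bool) :
    ∑ i, bordered A i j = 0 := by
  rcases j with j | (_ | _) <;> simp [bordered]

/-- The column of `inr false` holds the negated row sums of `A`, so `A` acts on differences from
that reference coordinate. A uniform shift of the state is thereby invisible. -/
theorem bordered_mulVec_inl {Q : Type} [Fintype Q] (A : Matrix Q Q ℝ) (v : Q ⊕ Bool → ℝ) (i : Q) :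
    (bordered A *ᵥ v) (.inl i) = (A *ᵥ fun j => v (.inl j) - v (.inr false)) i := by
  simp only [bordered, Matrix.mulVec, dotProduct, Fintype.sum_sum_type, Fintype.sum_bool,
    Matrix.fromBlocks_apply₁₁, Matrix.fromBlocks_apply₁₂, Matrix.of_apply, mul_sub,
    Finset.sum_sub_distrib, ← Finset.sum_mul, if_true, Bool.false_eq_true, if_false]
  ring

theorem bordered_mulVec_inr {Q : Type} [Fintype Q] (A : Matrix Q Q ℝ) (v : Q ⊕ Bool → ℝ) :
    (bordered A *ᵥ v) (.inr false) = 0 := by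
  simp [bordered, Matrix.mulVec, dotProduct]

/-- A small positive factor by which the bordered matrix is scaled. -/
noncomputable def scale {Q : Type} [Fintype Q] (A : Matrix Q Q ℝ) : ℝ :=
  (1 + ∑ i, ∑ j, |bordered A i j|)⁻¹

theorem scale_pos {Q : Type} [Fintype Q] (A : Matrix Q Q ℝ) : 0 < scale A := by
  unfold scale; positivity

/-- A stochastic matrix close to the uniform one, in which `A` is hidden as a perturbation. -/
noncomputable def hidden {Q : Type} [Fintype Q] (A : Matrix Q Q ℝ) :
    Matrix (Q ⊕ Bool) (Q ⊕ Bool) ℝ :=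
  Matrix.of fun i j => (1 + scale A * bordered A i j) / Fintype.card (Q ⊕ Bool)

theorem hidden_mem_colStochastic {Q : Type} [Fintype Q] [DecidableEq Q] (A : Matrix Q Q ℝ) :
    hidden A ∈ Matrix.colStochastic ℝ (Q ⊕ Bool) := by
  rw [Matrix.mem_colStochastic_iff_sum]
  refine ⟨fun i j => div_nonneg ?_ (Nat.cast_nonneg _), fun j => ?_⟩
  · have h1 : |bordered A i j| ≤ ∑ i, ∑ j, |bordered A i j| :=
      (Finset.single_le_sum (f := fun j => |bordered A i j|) (fun _ _ => abs_nonneg _)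
        (Finset.mem_univ j)).trans
      (Finset.single_le_sum (f := fun i => ∑ j, |bordered A i j|)
        (fun _ _ => Finset.sum_nonneg fun _ _ => abs_nonneg _) (Finset.mem_univ i))
    have h2 : |scale A * bordered A i j| ≤ 1 := by
      rw [abs_mul, abs_of_pos (scale_pos A), scale, inv_mul_le_iff₀ (by positivity)]
      linarith
    linarith [(abs_le.mp h2).1]
  · simp only [hidden, Matrix.of_apply]
    rw [← Finset.sum_div, Finset.sum_add_distrib, ← Finset.mul_sum, bordered_sum_col, mul_zero,
      add_zero, Finset.sum_const, Finset.card_univ, nsmul_eq_mul, mul_one]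
    exact div_self (Nat.cast_ne_zero.mpr Fintype.card_ne_zero)

theorem hidden_mulVec {Q : Type} [Fintype Q] (A : Matrix Q Q ℝ) (v : Q ⊕ Bool → ℝ)
    (hv : ∑ j, v j = 1) (i : Q ⊕ Bool) :
    (hidden A *ᵥ v) i = (1 + scale A * (bordered A *ᵥ v) i) / Fintype.card (Q ⊕ Bool) := by
  rw [← hv]
  simp only [hidden, Matrix.mulVec, dotProduct, Matrix.of_apply]
  rw [Finset.mul_sum, ← Finset.sum_add_distrib, Finset.sum_div]
  exact Finset.sum_congr rfl fun j _ => by ring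

/-- The reference coordinate takes the same value after every step; this value serves as the
cutpoint. -/
theorem hidden_mulVec_inr {Q : Type} [Fintype Q] (A : Matrix Q Q ℝ) (v : Q ⊕ Bool → ℝ)
    (hv : ∑ j, v j = 1) :
    (hidden A *ᵥ v) (.inr false) = (Fintype.card (Q ⊕ Bool) : ℝ)⁻¹ := by
  rw [hidden_mulVec A v hv, bordered_mulVec_inr, mul_zero, add_zero, one_div]

theorem IsSupport.mem_SLne {L : FormalLanguage} (hL : IsSupport L) : L ∈ SLne := by
  obtain ⟨n, A, s, h⟩ := hL.exists_run
  let P : PFA L.Alphabet (Fin n ⊕ Bool) :=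
    ⟨fun σ => hidden (A σ), fun σ => hidden_mem_colStochastic _, .inl s, {.inl s}⟩
  refine ⟨_, _, _, P, (Fintype.card (Fin n ⊕ Bool) : ℝ)⁻¹,
    ⟨by positivity, inv_le_one_of_one_le₀ (Nat.one_le_cast.mpr Fintype.card_pos)⟩, fun w => ?_⟩
  -- Invariant: the differences from the reference coordinate form a positive multiple of the
  -- simulated vector.
  let R : (Fin n ⊕ Bool → ℝ) → (Fin n → ℝ) → Prop := fun v y =>
    ∑ j, v j = 1 ∧ ∃ k > (0 : ℝ), (fun q => v (.inl q) - v (.inr false)) = k • y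
  have step : ∀ v y σ, R v y → R (P.trans σ *ᵥ v) (A σ *ᵥ y) := by
    rintro v y σ ⟨hv, k, hk, hvy⟩
    refine ⟨by rw [(IsAffine.of_colStochastic (P.stochastic σ)).sum_mulVec, hv],
      k * scale (A σ) / Fintype.card (Fin n ⊕ Bool), ?_, ?_⟩
    · have := scale_pos (A σ)
      have : 0 < Fintype.card (Fin n ⊕ Bool) := Fintype.card_pos
      positivity
    · funext q
      change (hidden (A σ) *ᵥ v) _ - (hidden (A σ) *ᵥ v) _ = _
      rw [hidden_mulVec _ _ hv, hidden_mulVec_inr _ _ hv, bordered_mulVec_inl, hvy,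
        Matrix.mulVec_smul]
      simp only [Pi.smul_apply, smul_eq_mul]
      ring
  have init : R (Pi.single P.start 1) (Pi.single s 1) := by
    refine ⟨by simp, 1, one_pos, ?_⟩
    funext q
    simp [P, Pi.single_apply]
  obtain ⟨-, k, hk, hR⟩ := foldl_rel R _ _ step (tape w) _ _ init
  -- The state before the right end-marker has sum one, as `hidden_mulVec_inr` needs for the last
  -- step.
  obtain ⟨hS, -⟩ := foldl_rel R _ _ step (Tape.left :: w.map Tape.letter) _ _ init
  have hu : P.finalState w (.inr false) = (Fintype.card (Fin n ⊕ Bool) : ℝ)⁻¹ := by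
    rw [PFA.finalState, tape, ← List.cons_append, List.foldl_append]
    exact hidden_mulVec_inr _ _ hS
  have hs : P.finalState w (.inl s) - P.finalState w (.inr false) = k * run A s (tape w) s :=
    congrFun hR s
  have hval : P.value w = P.finalState w (.inl s) := Finset.sum_singleton _ _
  rw [h w, hval, ← hu, ← sub_ne_zero (b := P.finalState w (.inr false)), hs]
  simp [hk.ne']

/-! ### Simulation by affine automata -/

/-- The matrix `A` with one further row which makes all column sums equal to one. -/
def affinized {Q : Type} [Fintype Q] (A : Matrix Q Q ℝ) : Matrix (Option Q) (Option Q) ℝ :=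
  Matrix.of fun i j => match i, j with
    | some i, some j => A i j
    | some _, none => 0
    | none, some j => 1 - ∑ i, A i j
    | none, none => 1

theorem affinized_isAffine {Q : Type} [Fintype Q] (A : Matrix Q Q ℝ) : IsAffine (affinized A) := by
  rintro (_ | j) <;> simp [affinized, Fintype.sum_option]

theorem IsSupport.mem_NAfL {L : FormalLanguage} (hL : IsSupport L) : L ∈ NAfL := by
  obtain ⟨n, A, s, h⟩ := hL.exists_run
  let M : AfA L.Alphabet (Option (Fin n)) :=
    ⟨fun σ => affinized (A σ), fun σ => affinized_isAffine _, some s, {some s}⟩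
  refine ⟨_, _, inferInstance, M, fun w => ?_⟩
  have key : (fun q => M.finalState w (some q)) = run A s (tape w) := by
    refine foldl_rel (fun (v : Option (Fin n) → ℝ) y => (fun q => v (some q)) = y) _ _ ?_ _ _ _ ?_
    · rintro v _ σ rfl
      funext q
      simp [M, affinized, Matrix.mulVec, dotProduct, Fintype.sum_option]
    · funext q
      simp [M, Pi.single_apply]
  rw [h w, M.value_pos_iff, M.value_ne_zero_iff, ← key]
  simp [M]

/-! ### Simulation by quantum automata -/

open scoped Matrix.Norms.L2Operator MatrixOrder in
/-- Every Hermitian matrix is bounded by a multiple of the identity. -/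
theorem exists_posSemidef_smul_one_sub {Q : Type} [Fintype Q] [DecidableEq Q]
    (G : Matrix Q Q ℂ) (hG : G.IsHermitian) :
    ∃ c > (0 : ℝ), ((c : ℂ) • (1 : Matrix Q Q ℂ) - G).PosSemidef := by
  refine ⟨‖G‖ + 1, by positivity, ?_⟩
  have h1 : G ≤ algebraMap ℝ _ ‖G‖ := IsSelfAdjoint.le_algebraMap_norm_self hG
  have h2 := (Matrix.le_iff.mp h1).add (Matrix.PosSemidef.one (n := Q) (R := ℂ))
  have h3 : ((‖G‖ + 1 : ℝ) : ℂ) • (1 : Matrix Q Q ℂ) - G = algebraMap ℝ _ ‖G‖ - G + 1 := by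
    ext i j
    by_cases hij : i = j
    · subst hij; simp [Matrix.algebraMap_matrix_apply]; ring
    · simp [Matrix.algebraMap_matrix_apply, hij]
  rw [h3]
  exact h2

open scoped Matrix.Norms.L2Operator MatrixOrder in
theorem exists_eq_conjTranspose_mul_self {Q : Type} [Fintype Q] [DecidableEq Q]
    {G : Matrix Q Q ℂ} (hG : G.PosSemidef) : ∃ B : Matrix Q Q ℂ, G = Bᴴ * B :=
  CStarAlgebra.nonneg_iff_eq_star_mul_self.mp hG.nonneg

/-- A matrix can be realized, up to a positive factor, by a superoperator with one further
basis state. -/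
theorem exists_superoperator {Q : Type} [Fintype Q] [DecidableEq Q] (A : Matrix Q Q ℂ) :
    ∃ (E : Superoperator (Option Q)) (k : ℝ), 0 < k ∧ ∀ ρ : Matrix (Option Q) (Option Q) ℂ,
      (E.apply ρ).submatrix some some = (k : ℂ) • (A * ρ.submatrix some some * Aᴴ) := by
  let A' : Matrix (Option Q) (Option Q) ℂ := Matrix.of fun i j => match i, j with
    | some i, some j => A i j
    | _, _ => 0
  obtain ⟨c, hc, hpos⟩ := exists_posSemidef_smul_one_sub (A'ᴴ * A')
    (Matrix.isHermitian_conjTranspose_mul_self A')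
  obtain ⟨B, hB⟩ : ∃ B : Matrix (Option Q) (Option Q) ℂ,
      (c : ℂ) • (1 : Matrix (Option Q) (Option Q) ℂ) - A'ᴴ * A' = Bᴴ * B :=
    exists_eq_conjTranspose_mul_self hpos
  let r : ℂ := ((Real.sqrt c)⁻¹ : ℝ)
  have hr : r * r = ((c⁻¹ : ℝ) : ℂ) := by
    rw [← Complex.ofReal_mul, ← mul_inv, Real.mul_self_sqrt hc.le]
  have hrs : star r = r := Complex.conj_ofReal _
  -- `F k` moves row `k` of `B` to row `none`. Together these complete the superoperator, yet they
  -- write only to the state `none` and leave the block over `Q` untouched.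
  let F : Option Q → Matrix (Option Q) (Option Q) ℂ := fun k =>
    Matrix.of fun i j => if i = none then B k j else 0
  let e := (Fintype.equivFin (Option Q)).symm
  have hF : ∑ k, (F k)ᴴ * F k = Bᴴ * B := by
    ext i j
    simp [F, Matrix.sum_apply, Matrix.mul_apply, Matrix.conjTranspose_apply, Fintype.sum_option]
  refine ⟨⟨Fintype.card (Option Q) + 1, Nat.succ_pos _,
    Fin.cons (r • A') fun k => r • F (e k), ?_⟩, c⁻¹, inv_pos.mpr hc, fun ρ => ?_⟩
  · rw [Fin.sum_univ_succ]
    simp only [Fin.cons_zero, Fin.cons_succ, Matrix.conjTranspose_smul, hrs, Matrix.smul_mul,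
      Matrix.mul_smul, smul_smul, hr]
    rw [← Finset.smul_sum, e.sum_comp (fun k => (F k)ᴴ * F k), hF, ← smul_add, ← hB,
      add_sub_cancel, smul_smul, ← Complex.ofReal_mul, inv_mul_cancel₀ hc.ne', Complex.ofReal_one,
      one_smul]
  · ext i j
    simp only [Superoperator.apply, Matrix.submatrix_apply]
    rw [Fin.sum_univ_succ]
    simp only [Fin.cons_zero, Fin.cons_succ, Matrix.conjTranspose_smul, hrs, Matrix.smul_mul,
      Matrix.mul_smul, smul_smul, hr]
    simp [F, A', Matrix.sum_apply, Matrix.mul_apply, Matrix.conjTranspose_apply,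
      Fintype.sum_option]

theorem IsSupport.mem_NQAL {L : FormalLanguage} (hL : IsSupport L) : L ∈ NQAL := by
  obtain ⟨n, A, s, h⟩ := hL.exists_run
  choose E k hk hE using fun σ => exists_superoperator ((A σ).map ((↑) : ℝ → ℂ))
  let M : QFA L.Alphabet (Option (Fin n)) := ⟨E, some s, {some s}⟩
  refine ⟨_, _, _, M, fun w => ?_⟩
  -- Invariant: away from `none`, the mixed state is a positive multiple of `y yᵀ`, so the value is
  -- a positive multiple of a square.
  obtain ⟨c, hc, hR⟩ := foldl_rel
    (fun (ρ : Matrix (Option (Fin n)) (Option (Fin n)) ℂ) (y : Fin n → ℝ) => ∃ c > (0 : ℝ),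
      ρ.submatrix some some = (c : ℂ) • (Matrix.vecMulVec y y).map ((↑) : ℝ → ℂ))
    (fun ρ σ => (M.trans σ).apply ρ) (fun v σ => A σ *ᵥ v) (by
      rintro ρ y σ ⟨c, hc, hρ⟩
      refine ⟨k σ * c, mul_pos (hk σ) hc, ?_⟩
      have h1 : ((A σ).map ((↑) : ℝ → ℂ))ᴴ = ((A σ)ᵀ).map ((↑) : ℝ → ℂ) := by
        ext i j; simp
      change ((E σ).apply ρ).submatrix some some = _
      rw [hE, hρ, h1, Matrix.mul_smul, Matrix.smul_mul, smul_smul, ← Complex.ofReal_mul]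
      congr 1
      change (A σ).map Complex.ofRealHom * (Matrix.vecMulVec y y).map Complex.ofRealHom *
        ((A σ)ᵀ).map Complex.ofRealHom = Matrix.map _ Complex.ofRealHom
      rw [← Matrix.map_mul, ← Matrix.map_mul, Matrix.mul_vecMulVec, Matrix.vecMulVec_mul,
        Matrix.vecMul_transpose])
    (tape w) (Matrix.single (some s) (some s) 1) (Pi.single s 1)
    ⟨1, one_pos, by
      ext i j
      rcases eq_or_ne s i with rfl | hi <;> rcases eq_or_ne s j with rfl | hj <;>
        simp [Matrix.vecMulVec_apply, *]⟩
  have hs : M.finalState w (some s) (some s) =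
      (c : ℂ) * ((run A s (tape w) s * run A s (tape w) s : ℝ) : ℂ) :=
    congrFun (congrFun hR s) s
  have hval : M.value w = c * (run A s (tape w) s * run A s (tape w) s) := by
    rw [QFA.value, show M.accept = {some s} from rfl, Finset.sum_singleton, hs,
      ← Complex.ofReal_mul, Complex.ofReal_re]
  rw [h w, hval, mul_pos_iff_of_pos_left hc, mul_self_pos]

theorem SLne_eq : SLne = {L | IsSupport L} :=
  Set.ext fun _ => ⟨IsSupport.of_SLne, IsSupport.mem_SLne⟩

theorem NQAL_eq : NQAL = {L | IsSupport L} :=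
  Set.ext fun _ => ⟨IsSupport.of_NQAL, IsSupport.mem_NQAL⟩

theorem NAfL_eq : NAfL = {L | IsSupport L} :=
  Set.ext fun _ => ⟨IsSupport.of_NAfL, IsSupport.mem_NAfL⟩

theorem NAfL_subset_AfLne : NAfL ⊆ AfLne := fun _ ⟨Q, i, j, M, h⟩ =>
  ⟨Q, i, j, M, 0, ⟨le_rfl, zero_le_one⟩, fun w => (h w).trans (M.value_pos_iff w)⟩

/-! ### `ABS-EQ` is not the zero set of a rational series -/

/-- There is a bound `k` such that a linear functional vanishing on `f ^ i x` for all large `i`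
vanishes on `f ^ k x`. -/
theorem exists_pow_apply_eq_zero {V : Type} [AddCommGroup V] [Module ℝ V] [FiniteDimensional ℝ V]
    (f : V →ₗ[ℝ] V) (φ : V →ₗ[ℝ] ℝ) :
    ∃ k, ∀ (x : V) (m : ℕ), (∀ i, m ≤ i → φ ((f ^ i) x) = 0) → φ ((f ^ k) x) = 0 := by
  obtain ⟨q, hq, hX⟩ := Polynomial.exists_eq_pow_rootMultiplicity_mul_and_not_dvd f.charpoly
    f.charpoly_monic.ne_zero 0
  rw [map_zero, sub_zero] at hq hX
  set k := f.charpoly.rootMultiplicity 0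
  refine ⟨k, fun x m h => ?_⟩
  have hco : IsCoprime q (Polynomial.X ^ m) :=
    ((Polynomial.irreducible_X.coprime_iff_not_dvd.mpr hX).symm).pow_right
  obtain ⟨a, b, hab⟩ := hco
  have h0 : Polynomial.aeval f (Polynomial.X ^ k * q) = 0 := by
    rw [← hq, LinearMap.aeval_self_charpoly]
  -- Multiplying the Bézout identity by `X ^ k` and reducing modulo the characteristic polynomial
  -- expresses `f ^ k` through powers at least `m + k`.
  have h1 : f ^ k = Polynomial.aeval f b * f ^ (m + k) := by
    calc f ^ k = Polynomial.aeval f (Polynomial.X ^ k * (a * q + b * Polynomial.X ^ m)) := by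
          rw [hab, mul_one, map_pow, Polynomial.aeval_X]
      _ = Polynomial.aeval f (a * (Polynomial.X ^ k * q) + b * Polynomial.X ^ (m + k)) := by
          congr 1; ring
      _ = _ := by
          rw [map_add, map_mul, h0, mul_zero, zero_add, map_mul, map_pow, Polynomial.aeval_X]
  rw [h1, Polynomial.aeval_eq_sum_range, Finset.sum_mul, LinearMap.sum_apply, map_sum]
  refine Finset.sum_eq_zero fun i _ => ?_
  rw [smul_mul_assoc, ← pow_add, LinearMap.smul_apply, map_smul, h _ (by omega), smul_zero]

theorem foldl_replicate_apply {σ V : Type} [AddCommGroup V] [Module ℝ V] (T : σ → V →ₗ[ℝ] V)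
    (s : σ) (n : ℕ) (x : V) :
    (List.replicate n s).foldl (fun x σ => T σ x) x = (T s ^ n) x := by
  induction n generalizing x with
  | zero => rfl
  | succ n ih => rw [List.replicate_succ, List.foldl_cons, ih, pow_succ, Module.End.mul_apply]

theorem foldl_tape_replicate {V : Type} [AddCommGroup V] [Module ℝ V]
    (T : Tape AB → V →ₗ[ℝ] V) (v : V) (m n : ℕ) :
    (tape (List.replicate m AB.a ++ List.replicate n AB.b)).foldl (fun x σ => T σ x) v =
      T .right ((T (.letter .b) ^ n) ((T (.letter .a) ^ m) (T .left v))) := by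
  simp only [tape, List.map_append, List.map_replicate, List.foldl_cons, List.foldl_append,
    foldl_replicate_apply, List.foldl_nil]

theorem abs_eq_iff_not_between {m n : ℤ} (hn : 0 ≤ n) :
    |m - n| + |m - 4 * n| = |m - 2 * n| + |m - 3 * n| ↔ m ≤ n ∨ 4 * n ≤ m := by
  rcases abs_cases (m - n) with h1 | h1 <;> rcases abs_cases (m - 4 * n) with h2 | h2 <;>
    rcases abs_cases (m - 2 * n) with h3 | h3 <;> rcases abs_cases (m - 3 * n) with h4 | h4 <;>
    omega

theorem not_isSupport_absEq_compl : ¬ IsSupport absEq.compl := by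
  rintro ⟨V, _, _, _, _, T, v, φ, h⟩
  change Tape AB → V →ₗ[ℝ] V at T
  obtain ⟨k, hk⟩ := exists_pow_apply_eq_zero (T (.letter AB.b)) (φ ∘ₗ T .right)
  have hval : ∀ m n : ℕ, (m ≤ n ∨ 4 * n ≤ m) ↔
      (φ ∘ₗ T .right) ((T (.letter AB.b) ^ n) ((T (.letter AB.a) ^ m) (T .left v))) = 0 := by
    intro m n
    have h1 := (h (List.replicate m AB.a ++ List.replicate n AB.b)).not_left
    have h2 : List.replicate m AB.a ++ List.replicate n AB.b ∉ absEq.compl.words ↔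
        (m ≤ n ∨ 4 * n ≤ m) := by
      refine not_not.trans ?_
      change |_| + |_| = |_| + |_| ↔ _
      rw [abs_eq_iff_not_between (by positivity)]
      simp [List.count_append, List.count_replicate]
      omega
    refine h2.symm.trans (h1.trans ?_)
    exact iff_of_eq (congrArg (φ · = 0) (foldl_tape_replicate T v m n))
  set x := (T (.letter AB.a) ^ (2 * k + 2)) (T .left v) with hx
  -- With `m = 2k + 2` the series vanishes for all `n ≥ m`, hence at `n = k + 1`, although `n < m <
  -- 4n`. Starting from one letter `b` keeps `n` positive: for `k = 0`, `n = k` would give no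
  -- contradiction.
  have h1 := hk (T (.letter AB.b) x) (2 * k + 2) fun i hi => by
    rw [← Module.End.mul_apply, ← pow_succ]
    exact (hval _ _).mp (.inl (by omega))
  rw [← Module.End.mul_apply, ← pow_succ, hx, ← hval] at h1
  omega

/-! ### An affine automaton for `ABS-EQ` -/

/-- The transitions of an automaton for `ABS-EQ`: the first two coordinates count the letters, the
third one keeps the sum equal to one, and the last step computes the four differences. -/
noncomputable def absEqTrans : Tape AB → Matrix (Fin 6) (Fin 6) ℝ
  | .left => 1
  | .letter .a =>
    !![2, 1, 1, 0, 0, 0; 0, 1, 0, 0, 0, 0; -1, -1, 0, 0, 0, 0;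
       0, 0, 0, 1, 0, 0; 0, 0, 0, 0, 1, 0; 0, 0, 0, 0, 0, 1]
  | .letter .b =>
    !![1, 0, 0, 0, 0, 0; 1, 2, 1, 0, 0, 0; -1, -1, 0, 0, 0, 0;
       0, 0, 0, 1, 0, 0; 0, 0, 0, 0, 1, 0; 0, 0, 0, 0, 0, 1]
  | .right =>
    -- The signs make the four differences sum to zero. The remaining mass one is split equally
    -- between an accepting and a rejecting state, so value one half means equality of the two sums
    -- of absolute values.
    !![1, -1, 0, 0, 0, 0; 1, -4, 0, 0, 0, 0; -1, 2, 0, 0, 0, 0; -1, 3, 0, 0, 0, 0;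
       1 / 2, 1 / 2, 1 / 2, 1 / 2, 1 / 2, 1 / 2; 1 / 2, 1 / 2, 1 / 2, 1 / 2, 1 / 2, 1 / 2]

/-- An affine automaton which accepts exactly the words of `ABS-EQ` with value one half. -/
noncomputable def absEqAfA : AfA AB (Fin 6) where
  trans := absEqTrans
  affine σ j := by
    rcases σ with _ | (_ | _) | _ <;> fin_cases j <;>
      norm_num [absEqTrans, Fin.sum_univ_succ, Matrix.one_apply]
  start := 2
  accept := {0, 1, 4}

theorem foldl_absEqTrans (w : List AB) (m n : ℝ) :
    (w.map Tape.letter).foldl (fun v σ => absEqTrans σ *ᵥ v) ![m, n, 1 - m - n, 0, 0, 0] =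
      ![m + w.count AB.a, n + w.count AB.b, 1 - (m + w.count AB.a) - (n + w.count AB.b),
        0, 0, 0] := by
  induction w generalizing m n with
  | nil => simp
  | cons s w ih =>
    rw [List.map_cons, List.foldl_cons]
    cases s
    · have h : absEqTrans (.letter .a) *ᵥ ![m, n, 1 - m - n, 0, 0, 0] =
          ![m + 1, n, 1 - (m + 1) - n, 0, 0, 0] := by
        ext i
        fin_cases i <;> simp [absEqTrans, Matrix.mulVec, dotProduct, Fin.sum_univ_succ] <;> ring
      rw [h, ih]
      simp [add_comm, add_left_comm]
    · have h : absEqTrans (.letter .b) *ᵥ ![m, n, 1 - m - n, 0, 0, 0] =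
          ![m, n + 1, 1 - m - (n + 1), 0, 0, 0] := by
        ext i
        fin_cases i <;> simp [absEqTrans, Matrix.mulVec, dotProduct, Fin.sum_univ_succ] <;> ring
      rw [h, ih]
      simp [add_comm, add_left_comm]

theorem absEqAfA_finalState (w : List AB) :
    absEqAfA.finalState w =
      ![(w.count AB.a : ℝ) - w.count AB.b, w.count AB.a - 4 * w.count AB.b,
        -(w.count AB.a - 2 * w.count AB.b), -(w.count AB.a - 3 * w.count AB.b), 1 / 2, 1 / 2] := by
  have h0 : (Pi.single absEqAfA.start 1 : Fin 6 → ℝ) = ![0, 0, 1 - 0 - 0, 0, 0, 0] := by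
    ext i
    fin_cases i <;> simp [absEqAfA]
  have h1 : absEqAfA.trans = absEqTrans := rfl
  rw [AfA.finalState, tape, List.foldl_cons, List.foldl_append, h0, h1,
    show absEqTrans .left = 1 from rfl, Matrix.one_mulVec, foldl_absEqTrans]
  ext i
  fin_cases i <;> simp [absEqTrans] <;> ring

theorem absEqAfA_value_eq_iff (w : List AB) :
    absEqAfA.value w = 1 / 2 ↔
      |(w.count AB.a : ℝ) - w.count AB.b| + |(w.count AB.a : ℝ) - 4 * w.count AB.b| =
        |(w.count AB.a : ℝ) - 2 * w.count AB.b| + |(w.count AB.a : ℝ) - 3 * w.count AB.b| := by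
  rw [AfA.value, ← Finset.sum_div, div_eq_iff (zero_lt_one.trans_le (absEqAfA.one_le_norm w)).ne',
    absEqAfA_finalState, show absEqAfA.accept = {0, 1, 4} from rfl,
    Finset.sum_insert (by decide), Finset.sum_insert (by decide), Finset.sum_singleton]
  simp only [Fin.sum_univ_six, Matrix.cons_val, abs_neg, abs_of_pos (one_half_pos (α := ℝ))]
  constructor <;> intro h <;> linarith

theorem absEq_compl_mem_AfLne : absEq.compl ∈ AfLne := by
  refine ⟨Fin 6, inferInstance, inferInstance, absEqAfA, 1 / 2, by norm_num, fun w => ?_⟩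
  refine not_congr (Iff.trans ?_ (absEqAfA_value_eq_iff w).symm)
  change |_| + |_| = |_| + |_| ↔ _
  rw [← Int.cast_inj (α := ℝ)]
  push_cast
  rfl

end AffineAutomata

theorem mainTheorem3 :
    (AffineAutomata.SLeq = AffineAutomata.co AffineAutomata.NQAL ∧
      AffineAutomata.co AffineAutomata.NQAL = AffineAutomata.co AffineAutomata.NAfL ∧
      AffineAutomata.co AffineAutomata.NAfL ⊂ AffineAutomata.AfLeq) ∧
    (AffineAutomata.SLne = AffineAutomata.NQAL ∧
      AffineAutomata.NQAL = AffineAutomata.NAfL ∧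
      AffineAutomata.NAfL ⊂ AffineAutomata.AfLne) ∧
    (AffineAutomata.absEq ∈ AffineAutomata.AfLeq ∧
      AffineAutomata.absEq ∉ AffineAutomata.SLeq) ∧
    (AffineAutomata.absEq.compl ∈ AffineAutomata.AfLne ∧
      AffineAutomata.absEq.compl ∉ AffineAutomata.SLne) := by
  open AffineAutomata in
  have h1 : SLne = NQAL := SLne_eq.trans NQAL_eq.symm
  have h2 : NQAL = NAfL := NQAL_eq.trans NAfL_eq.symm
  have h3 : absEq.compl ∈ AfLne := absEq_compl_mem_AfLne
  have h4 : absEq.compl ∉ NAfL := fun h => not_isSupport_absEq_compl (IsSupport.of_NAfL h)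
  have h5 : absEq.compl ∉ SLne := fun h => not_isSupport_absEq_compl (IsSupport.of_SLne h)
  exact ⟨⟨congrArg co h1, congrArg co h2, fun _ h => NAfL_subset_AfLne h,
      fun h => h4 (h (show absEq ∈ AfLeq from h3))⟩,
    ⟨h1, h2, NAfL_subset_AfLne, fun h => h4 (h h3)⟩, ⟨h3, h5⟩, h3, h5⟩
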